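/- A $1$-limited automaton is a nondeterministic single-tape machine with finite state set $Q$, finite input alphabet $\Sigma$, finite work alphabet $\Gamma\supseteq\Sigma\cup\{\rhd,\lhd\}$ (where the left and right end-markers $\rhd,\lhd$ are not in $\Sigma$), transition function $\delta:Q\times\Gamma\to 2^{Q\times(\Gamma\setminus\{\rhd,\lhd\})\times\{-1,+1\}}$, an initial state and a set of final states. On input $w\in\Sigma^*$ the tape holds $\rhd w\lhd$, with $\rhd$ in position $0$, and the head starts on position $1$. In a move the machine changes state, rewrites the scanned cell and moves the head by one position. The cells of the end-markers are never modified, every other cell may be modified only during its first visit, and the head may not pass $\rhd$. The input is accepted if some computation ends in a final state after passing $\lhd$. The automaton is always marking if $\Gamma$ contains a set $\{\overline a\mid a\in\Sigma\}$ of marked versions of the input symbols (pairwise distinct, and disjoint from $\Sigma\cup\{\rhd,\lhd\}$) and, each time the head visits a tape cell for the first time, the input symbol $a$ in it is replaced with $\overline a$. Theorem. For every always-marking $1$-limited automaton with $n$ states there are (1) a one-way nondeterministic finite automaton (with a single initial state and without $\varepsilon$-moves) with at most $n\cdot 2^{n^2}$ states, and (2) a complete one-way deterministic finite automaton with at most $(2^n-1)\cdot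 2^{n^2}+1$ states, each of which accepts the same language as the given automaton. -/

import Mathlib

/-- The symbols of the tape: the two end-markers and the other work symbols. If `Γ` is the type of
the work symbols other than the end-markers, then the whole work alphabet is `TapeSymbol Γ`. -/
inductive TapeSymbol (Γ : Type*) where
  | leftEnd : TapeSymbol Γ
  | rightEnd : TapeSymbol Γ
  | sym (g : Γ) : TapeSymbol Γ

/-- A nondeterministic single-tape machine with states `Q`, input alphabet `A` and work alphabet
`TapeSymbol Γ`, which contains the input alphabet through `input`. The transition function never
writes an end-marker. -/
structure TapeMachine (Q A Γ : Type*) where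
  /-- the inclusion of the input alphabet in the work alphabet -/
  input : A ↪ Γ
  /-- the transition function -/
  δ : Q → TapeSymbol Γ → Set (Q × Γ × Turing.Dir)
  /-- the initial state -/
  start : Q
  /-- the final states -/
  final : Set Q

namespace TapeMachine

/-- A configuration. Position `0` of the tape holds the left end-marker, the positions
`1, …, cells.length` hold the symbols of `cells`, and position `cells.length + 1` holds the right
end-marker. The head on position `cells.length + 2` has passed the right end-marker. The
set `visited` collects the positions on which the head was before the current moment. -/
@[ext] structure Config (Q Γ : Type*) where
  /-- the state of the finite control -/
  state : Q
  /-- the tape between the end-markers -/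
  cells : List Γ
  /-- the position of the head -/
  head : ℕ
  /-- the positions visited earlier -/
  visited : Set ℕ

/-- The symbol in a given position of the tape. -/
def symbolAt {Γ : Type*} (cells : List Γ) : ℕ → TapeSymbol Γ
  | 0 => TapeSymbol.leftEnd
  | i + 1 =>
    match cells[i]? with
    | some g => TapeSymbol.sym g
    | none => TapeSymbol.rightEnd

/-- The tape after writing `g` in a given position. The end-markers are never modified
(`List.set` does nothing when the index is out of range). -/
def write {Γ : Type*} (cells : List Γ) : ℕ → Γ → List Γ
  | 0, _ => cells
  | i + 1, g => cells.set i g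

variable {Q A Γ : Type*}

/-- One move. The head never passes the left end-marker, and there is no move once it has passed
the right end-marker. -/
inductive Step (M : TapeMachine Q A Γ) : Config Q Γ → Config Q Γ → Prop
  | moveRight {q q' : Q} {cells : List Γ} {i : ℕ} {visited : Set ℕ} {g : Γ}
      (hi : i ≤ cells.length + 1)
      (h : (q', g, Turing.Dir.right) ∈ M.δ q (symbolAt cells i)) :
      Step M ⟨q, cells, i, visited⟩ ⟨q', write cells i g, i + 1, insert i visited⟩
  | moveLeft {q q' : Q} {cells : List Γ} {i : ℕ} {visited : Set ℕ} {g : Γ}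
      (hi : i + 1 ≤ cells.length + 1)
      (h : (q', g, Turing.Dir.left) ∈ M.δ q (symbolAt cells (i + 1))) :
      Step M ⟨q, cells, i + 1, visited⟩ ⟨q', write cells (i + 1) g, i, insert (i + 1) visited⟩

/-- The initial configuration on input `w`: the head is on position `1`. -/
def init (M : TapeMachine Q A Γ) (w : List A) : Config Q Γ :=
  ⟨M.start, w.map M.input, 1, ∅⟩

/-- The configurations that occur in the computations on input `w`. -/
def Reachable (M : TapeMachine Q A Γ) (w : List A) (c : Config Q Γ) : Prop :=
  Relation.ReflTransGen M.Step (M.init w) c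

/-- The accepted language: some computation ends in a final state after passing the right
end-marker. -/
def language (M : TapeMachine Q A Γ) : Language A :=
  {w | ∃ c, M.Reachable w c ∧ c.head = w.length + 2 ∧ c.state ∈ M.final}

/-- The machine is a `1`-limited automaton: in every computation, a move from an already visited
cell leaves the content of that cell unchanged. -/
def IsOneLimited (M : TapeMachine Q A Γ) : Prop :=
  ∀ (w : List A) (c c' : Config Q Γ), M.Reachable w c → M.Step c c' →
    c.head ∈ c.visited → c'.cells = c.cells

/-- The machine is always marking: the work alphabet contains a copy of the input alphabet, disjoint
from it, that consists of the marked versions of the input symbols, and in every computation a move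
from a tape cell visited for the first time replaces the input symbol `a` in it with `mark a`. -/
def IsAlwaysMarking (M : TapeMachine Q A Γ) : Prop :=
  ∃ mark : A → Γ, Function.Injective mark ∧ (∀ a b, mark a ≠ M.input b) ∧
    ∀ (w : List A) (c c' : Config Q Γ), M.Reachable w c → M.Step c c' →
      c.head ∉ c.visited →
        ∀ (i : ℕ) (a : A), c.head = i + 1 → w[i]? = some a → c'.cells[i]? = some (mark a)

end TapeMachine

/-! A visited cell permanently holds the marked copy of its letter, so the visited part of the tape
is determined by the input prefix. Seen from the right, it acts only through its crossing relation
on `Q`: which states entering its last cell can lead to which states leaving it to the right. There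
are `2 ^ (n ^ 2)` relations, and the next one depends only on the current one and the new letter. A
one-way automaton thus stores this relation with one guessed state, or with the set of all states,
in which the next new cell can be reached; pairs with the empty set form a single trap. The core is
`mem_language_iff_frontier`: `mem_language_iff_sweep` replaces configurations by triples (state,
head, last visited position), and `exists_sweep_iff` cuts computations at first visits. -/

namespace TapeMachine

open Turing

variable {Q A Γ : Type*}

/-! ### Crossing relations of the visited prefix -/

section Crossing

variable (M : TapeMachine Q A Γ)

/-- A move of the machine, with the written symbol ignored. -/
def Move (q : Q) (s : TapeSymbol Γ) (q' : Q) (d : Dir) : Prop :=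
  ∃ g, (q', g, d) ∈ M.δ q s

/-- `M.Exit τ s q p`: starting in state `q` on a cell that permanently holds `s`, the machine can
leave it to the right in state `p`, where `τ` describes the excursions to the left of the cell. -/
inductive Exit (τ : Q → Q → Prop) (s : TapeSymbol Γ) : Q → Q → Prop
  | right {q p : Q} (h : M.Move q s p Dir.right) : Exit τ s q p
  | left {q q₁ q₂ p : Q} (h : M.Move q s q₁ Dir.left) (hτ : τ q₁ q₂) (he : Exit τ s q₂ p) :
      Exit τ s q p

/-- Like `TapeMachine.Exit`, but the cell holds `f` during the first visit and `s` later. -/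
def FirstExit (τ : Q → Q → Prop) (f s : TapeSymbol Γ) (q p : Q) : Prop :=
  M.Move q f p Dir.right ∨ ∃ q₁ q₂, M.Move q f q₁ Dir.left ∧ τ q₁ q₂ ∧ M.Exit τ s q₂ p

/-- Needed for the right end-marker, which looks the same at every visit. -/
theorem firstExit_self {τ : Q → Q → Prop} {s : TapeSymbol Γ} {q p : Q} :
    M.FirstExit τ s s q p ↔ M.Exit τ s q p := by
  constructor
  · rintro (h | ⟨q₁, q₂, h, hτ, he⟩)
    · exact .right h
    · exact .left h hτ he
  · rintro (h | ⟨h, hτ, he⟩)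
    · exact .inl h
    · exact .inr ⟨_, _, h, hτ, he⟩

/-- The crossing relation of the positions `0, …, j` of a tape with permanent content `m`. -/
def crossing (m : ℕ → TapeSymbol Γ) : ℕ → Q → Q → Prop
  | 0 => M.Exit (fun _ _ => False) (m 0)
  | j + 1 => M.Exit (crossing m j) (m (j + 1))

/-- The states in which the machine can visit the position `j + 1` for the first time, if the
cells hold the symbols `f` during their first visits and the symbols `m` later. -/
def frontier (f m : ℕ → TapeSymbol Γ) : ℕ → Set Q
  | 0 => {M.start}
  | j + 1 => {p | ∃ q ∈ frontier f m j, M.FirstExit (M.crossing m j) (f (j + 1)) (m (j + 1)) q p}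

end Crossing

/-! ### Computations cut at first visits -/

section Sweep

variable (M : TapeMachine Q A Γ) (n : ℕ) (f m : ℕ → TapeSymbol Γ)

/-- One move in terms of the state, the position of the head, and the last position that has been
visited earlier. The last position of the tape is `n + 1`. -/
def SweepStep (x y : Q × ℕ × ℕ) : Prop :=
  x.2.1 ≤ n + 1 ∧ y.2.2 = max x.2.2 x.2.1 ∧
    ∃ d, M.Move x.1 (if x.2.1 ≤ x.2.2 then m x.2.1 else f x.2.1) y.1 d ∧
      (d = Dir.right ∧ y.2.1 = x.2.1 + 1 ∨ d = Dir.left ∧ x.2.1 = y.2.1 + 1)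

/-- The reachability relation of `TapeMachine.SweepStep`. -/
abbrev Sweep : Q × ℕ × ℕ → Q × ℕ × ℕ → Prop :=
  Relation.ReflTransGen (M.SweepStep n f m)

variable {M n f m}

theorem Exit.sweep {τ : Q → Q → Prop} {j k : ℕ} {q p : Q} (h : M.Exit τ (m (j + 1)) q p)
    (hτ : ∀ q p, τ q p → M.Sweep n f m (q, j, k) (p, j + 1, k)) (hjk : j + 1 ≤ k)
    (hj : j + 1 ≤ n + 1) : M.Sweep n f m (q, j + 1, k) (p, j + 2, k) := by
  induction h with
  | right h =>
    exact .single ⟨hj, (max_eq_left hjk).symm, Dir.right, by simpa [hjk] using h, .inl ⟨rfl, rfl⟩⟩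
  | left h h' _ ih =>
    refine .head (b := (_, j, k)) ⟨hj, (max_eq_left hjk).symm, Dir.left, ?_, .inr ⟨rfl, rfl⟩⟩
      ((hτ _ _ h').trans ih)
    simpa [hjk] using h

/-- Inside the visited region only `m` is read and no new cell is met, so `k` stays fixed. -/
theorem sweep_of_crossing {j k : ℕ} {q p : Q} (h : M.crossing m j q p) (hjk : j ≤ k)
    (hj : j ≤ n + 1) : M.Sweep n f m (q, j, k) (p, j + 1, k) := by
  induction j generalizing q p with
  | zero =>
    rcases h with h | ⟨_, hτ, _⟩
    · exact .single ⟨hj, (max_eq_left hjk).symm, Dir.right, by simpa using h, .inl ⟨rfl, rfl⟩⟩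
    · exact hτ.elim
  | succ j ih => exact Exit.sweep h (fun q p h => ih h (by omega) (by omega)) hjk hj

theorem sweep_of_mem_frontier {j : ℕ} {p : Q} (h : p ∈ M.frontier f m j) (hj : j ≤ n + 1) :
    M.Sweep n f m (M.start, 1, 0) (p, j + 1, j) := by
  induction j generalizing p with
  | zero => rw [Set.mem_singleton_iff.1 h]
  | succ j ih =>
    obtain ⟨q, hq, h⟩ := h
    refine (ih hq (by omega)).trans ?_
    rcases h with h | ⟨q₁, q₂, h, hτ, he⟩
    · exact .single ⟨hj, by simp, Dir.right, by simpa using h, .inl ⟨rfl, rfl⟩⟩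
    · refine .head (b := (q₁, j, j + 1)) ⟨hj, by simp, Dir.left, by simpa using h,
        .inr ⟨rfl, rfl⟩⟩ ?_
      exact (sweep_of_crossing hτ (by omega) (by omega)).trans
        (he.sweep (fun _ _ h => sweep_of_crossing h (by omega) (by omega)) le_rfl hj)

variable (M m) in
/-- `M.Climb m k i q p`: the crossing relations lead from the state `q` on position `i` to the
state `p` on position `k + 1`. -/
inductive Climb (k : ℕ) : ℕ → Q → Q → Prop
  | refl (p : Q) : Climb k (k + 1) p p
  | step {i : ℕ} {q q' p : Q} (hi : i ≤ k) (h : M.crossing m i q q') (hc : Climb k (i + 1) q' p) :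
      Climb k i q p

theorem Climb.eq {k : ℕ} {q p : Q} (h : M.Climb m k (k + 1) q p) : q = p := by
  cases h with
  | refl => rfl
  | step hi => omega

theorem Climb.exists_crossing {k i : ℕ} {q p : Q} (h : M.Climb m k i q p) (hi : i ≤ k) :
    ∃ q', M.crossing m i q q' ∧ M.Climb m k (i + 1) q' p := by
  cases h with
  | refl => omega
  | step _ h hc => exact ⟨_, h, hc⟩

theorem crossing_of_right {i : ℕ} {q p : Q} (h : M.Move q (m i) p Dir.right) :
    M.crossing m i q p := by
  cases i <;> exact .right h

/-- A computation that ends right of the tape factors through the first visit of the next new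
position. -/
theorem exists_climb {r : Q} {k' : ℕ} {x : Q × ℕ × ℕ}
    (h : M.Sweep n f m x (r, n + 2, k')) (hx : x.2.1 ≤ x.2.2 + 1) (hk' : x.2.2 ≤ n + 1) :
    ∃ p, M.Climb m x.2.2 x.2.1 x.1 p ∧ (p ∈ M.frontier f m x.2.2 → r ∈ M.frontier f m (n + 1)) := by
  induction h using Relation.ReflTransGen.head_induction_on with
  | refl =>
    simp only at hx hk'
    -- No position can be skipped, so a head beyond the tape has visited all of it.
    obtain rfl : k' = n + 1 := by omega
    exact ⟨r, .refl r, id⟩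
  | @head x y hxy _ ih =>
    obtain ⟨q, i, k⟩ := x
    obtain ⟨q', i', k''⟩ := y
    obtain ⟨hi, hk, d, hm, hd⟩ := hxy
    simp only at hx hk' hi hk hm hd ih ⊢
    obtain ⟨p, hc, hp⟩ := ih (by omega) (by omega)
    rcases Nat.lt_or_ge k i with hik | hik
    · obtain rfl : i = k + 1 := by omega
      obtain rfl : k'' = k + 1 := by omega
      rw [if_neg (by omega)] at hm
      refine ⟨q, .refl q, fun hq => hp ⟨q, hq, ?_⟩⟩
      rcases hd with ⟨rfl, rfl⟩ | ⟨rfl, hd⟩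
      · exact .inl (hc.eq ▸ hm)
      · obtain rfl : i' = k := by omega
        obtain ⟨q₁, h₁, hc⟩ := hc.exists_crossing (by omega)
        obtain ⟨q₂, h₂, hc⟩ := hc.exists_crossing le_rfl
        exact .inr ⟨q', q₁, hm, h₁, hc.eq ▸ h₂⟩
    · obtain rfl : k'' = k := by omega
      rw [if_pos hik] at hm
      refine ⟨p, ?_, hp⟩
      rcases hd with ⟨rfl, rfl⟩ | ⟨rfl, rfl⟩
      · exact .step hik (crossing_of_right hm) hc
      -- The crossing of `i'` ends the excursion to the left, the next one leaves the current cell;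
      -- with the left move in front they merge into one crossing.
      · obtain ⟨q₁, h₁, hc⟩ := hc.exists_crossing (by omega)
        obtain ⟨q₂, h₂, hc⟩ := hc.exists_crossing hik
        exact .step hik (.left hm h₁ h₂) hc

theorem exists_sweep_iff {r : Q} :
    (∃ k, M.Sweep n f m (M.start, 1, 0) (r, n + 2, k)) ↔ r ∈ M.frontier f m (n + 1) := by
  constructor
  · rintro ⟨k, h⟩
    -- For `k = 0` the climb starts at its target, position `1`, so `p` is the initial state.
    obtain ⟨p, hc, hp⟩ := exists_climb h le_rfl (Nat.zero_le _)
    exact hp hc.eq.symm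
  · exact fun h => ⟨_, sweep_of_mem_frontier h le_rfl⟩

end Sweep

/-! ### Configurations versus triples -/

section Simulation

variable (M : TapeMachine Q A Γ) (mark : A → Γ)

/-- The tape on input `w` when the first `k` cells have been marked. -/
def markedTape (w : List A) (k : ℕ) : List Γ :=
  (w.take k).map mark ++ (w.drop k).map M.input

/-- The configuration `c` on input `w` has the given state and position of the head, and its
positions visited earlier are `1, …, k`, possibly together with `0`. -/
structure Represents (w : List A) (x : Q × ℕ × ℕ) (c : Config Q Γ) : Prop where
  state : c.state = x.1
  head : c.head = x.2.1
  cells : c.cells = M.markedTape mark w x.2.2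
  visited : ∀ i, i + 1 ∈ c.visited ↔ i + 1 ≤ x.2.2
  head_le : x.2.1 ≤ x.2.2 + 1

variable {M mark}

@[simp]
theorem length_markedTape (w : List A) (k : ℕ) : (M.markedTape mark w k).length = w.length := by
  simp [markedTape]; omega

theorem getElem?_markedTape (w : List A) (k i : ℕ) :
    (M.markedTape mark w k)[i]? = w[i]?.map (if i < k then mark else M.input) := by
  unfold markedTape
  split_ifs with h
  · by_cases hi : i < w.length
    · rw [List.getElem?_append_left (by simp; omega)]
      simp [h]
    · rw [List.getElem?_eq_none (by simp; omega), List.getElem?_eq_none (by omega)]; rfl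
  · by_cases hi : i < w.length
    · rw [List.getElem?_append_right (by simp; omega)]
      simp only [List.length_map, List.length_take, List.getElem?_map, List.getElem?_drop]
      congr 2
      omega
    · rw [List.getElem?_eq_none (by simp; omega), List.getElem?_eq_none (by omega)]; rfl

theorem symbolAt_markedTape (w : List A) (k i : ℕ) :
    symbolAt (M.markedTape mark w k) i =
      if i ≤ k then symbolAt (w.map mark) i else symbolAt (w.map M.input) i := by
  cases i with
  | zero => simp [symbolAt]
  | succ i =>
    simp only [symbolAt, getElem?_markedTape, List.getElem?_map, Nat.succ_le_iff]
    split_ifs <;> rfl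

/-- A new letter cell gets marked, an old one is unchanged by 1-limitedness, and on an end-marker
`write` has no effect. -/
theorem write_eq_markedTape {w : List A} {x : Q × ℕ × ℕ} {c c' : Config Q Γ} {g : Γ}
    (hlim : c.head ∈ c.visited → c'.cells = c.cells)
    (hmark : c.head ∉ c.visited → ∀ (i : ℕ) (a : A), c.head = i + 1 → w[i]? = some a →
      c'.cells[i]? = some (mark a))
    (hx : M.Represents mark w x c) (hg : c'.cells = write c.cells c.head g) :
    c'.cells = M.markedTape mark w (max x.2.2 x.2.1) := by
  obtain ⟨q, i, k⟩ := x
  have hh : c.head = i := hx.head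
  have hcells : c.cells = M.markedTape mark w k := hx.cells
  have hle : i ≤ k + 1 := hx.head_le
  simp only
  cases i with
  | zero => rw [hg, hh, write, hcells, Nat.max_zero]
  | succ i =>
    have hv := hx.visited i
    simp only at hv
    rcases Nat.lt_or_ge k (i + 1) with h | h
    · obtain rfl : i = k := by omega
      have hmk := hmark (by rw [hh, hv]; omega) i
      rw [hg, hh, write, hcells] at hmk ⊢
      rw [max_eq_right h.le]
      ext1 j
      rcases eq_or_ne i j with rfl | hij
      · rcases hw : w[i]? with _ | a
        · have := List.getElem?_eq_none_iff.1 hw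
          rw [List.getElem?_eq_none (by simpa using this),
            List.getElem?_eq_none (by simpa using this)]
        · rw [hmk a rfl hw, getElem?_markedTape, hw, if_pos (by omega)]; rfl
      · rw [List.getElem?_set_ne hij, getElem?_markedTape, getElem?_markedTape]
        congr 1
        exact if_congr (by omega) rfl rfl
    · rw [hlim (by rw [hh, hv]; exact h), hcells, max_eq_left h]

variable (hlim : M.IsOneLimited)
  (hmark : ∀ (w : List A) (c c' : Config Q Γ), M.Reachable w c → M.Step c c' →
      c.head ∉ c.visited →
        ∀ (i : ℕ) (a : A), c.head = i + 1 → w[i]? = some a → c'.cells[i]? = some (mark a))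

theorem mem_insert_head_iff {i k : ℕ} {V : Set ℕ} (hV : ∀ j, j + 1 ∈ V ↔ j + 1 ≤ k)
    (hi : i ≤ k + 1) (j : ℕ) : j + 1 ∈ insert i V ↔ j + 1 ≤ max k i := by
  rw [Set.mem_insert_iff, hV]; omega

include hlim hmark in
theorem Represents.exists_sweepStep {w : List A} {x : Q × ℕ × ℕ} {c c' : Config Q Γ}
    (hx : M.Represents mark w x c) (hc : M.Reachable w c) (h : M.Step c c') :
    ∃ y, M.SweepStep w.length (symbolAt (w.map M.input)) (symbolAt (w.map mark)) x y ∧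
      M.Represents mark w y c' := by
  have hw := fun g => write_eq_markedTape (g := g) (hlim w c c' hc h) (hmark w c c' hc h) hx
  obtain ⟨q, i, k⟩ := x
  have hle : i ≤ k + 1 := hx.head_le
  have hs := symbolAt_markedTape (M := M) (mark := mark) w k i
  have hV := mem_insert_head_iff hx.visited hx.head_le
  have hcells : c.cells = M.markedTape mark w k := hx.cells
  have hst := hx.state
  have hh := hx.head
  cases h with
  | @moveRight q₀ q' cells i₀ V g hi hδ =>
    simp only at hst hh hcells hV
    subst hst hh hcells
    refine ⟨(q', i₀ + 1, max k i₀), ⟨by simpa using hi, rfl, Dir.right, ⟨g, ?_⟩, .inl ⟨rfl, rfl⟩⟩,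
      rfl, rfl, hw g rfl, hV, by simp⟩
    exact hs ▸ hδ
  | @moveLeft q₀ q' cells i₀ V g hi hδ =>
    simp only at hst hh hcells hV
    subst hst hh hcells
    refine ⟨(q', i₀, max k (i₀ + 1)), ⟨by simpa using hi, rfl, Dir.left, ⟨g, ?_⟩,
      .inr ⟨rfl, rfl⟩⟩, rfl, rfl, hw g rfl, hV, by simp only; omega⟩
    exact hs ▸ hδ

theorem Represents.exists_step {w : List A} {x y : Q × ℕ × ℕ} {c : Config Q Γ}
    (hx : M.Represents mark w x c)
    (h : M.SweepStep w.length (symbolAt (w.map M.input)) (symbolAt (w.map mark)) x y) :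
    ∃ c', M.Step c c' ∧ c'.state = y.1 ∧ c'.head = y.2.1 := by
  obtain ⟨q, i, k⟩ := x
  obtain ⟨q', i', k'⟩ := y
  obtain ⟨hi, -, d, ⟨g, hδ⟩, hd⟩ := h
  obtain ⟨q₀, cells, i₀, V⟩ := c
  obtain ⟨hst, hh, hcells, -, -⟩ := hx
  simp only at hst hh hcells hi hδ hd
  subst hst hh hcells
  rw [← symbolAt_markedTape] at hδ
  rcases hd with ⟨rfl, rfl⟩ | ⟨rfl, rfl⟩
  · exact ⟨_, .moveRight (by simpa using hi) hδ, rfl, rfl⟩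
  · exact ⟨_, .moveLeft (by simpa using hi) hδ, rfl, rfl⟩

theorem represents_init (w : List A) : M.Represents mark w (M.start, 1, 0) (M.init w) :=
  ⟨rfl, rfl, by simp [init, markedTape], by simp [init], le_rfl⟩

/-- The last visited position is a function of the source, which identifies the triple given by
`exists_sweepStep` with the prescribed one. -/
theorem SweepStep.eq_of_state_head {n : ℕ} {f m : ℕ → TapeSymbol Γ} {x y z : Q × ℕ × ℕ}
    (hy : M.SweepStep n f m x y) (hz : M.SweepStep n f m x z) (h₁ : y.1 = z.1)
    (h₂ : y.2.1 = z.2.1) : y = z :=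
  Prod.ext h₁ (Prod.ext h₂ (hy.2.1.trans hz.2.1.symm))

include hlim hmark in
theorem mem_language_iff_sweep (w : List A) :
    w ∈ M.language ↔ ∃ r ∈ M.final, ∃ k,
      M.Sweep w.length (symbolAt (w.map M.input)) (symbolAt (w.map mark))
        (M.start, 1, 0) (r, w.length + 2, k) := by
  constructor
  · rintro ⟨c, hc, hh, hf⟩
    obtain ⟨⟨q, i, k⟩, hx, hs⟩ : ∃ x, M.Represents mark w x c ∧ M.Sweep w.length
        (symbolAt (w.map M.input)) (symbolAt (w.map mark)) (M.start, 1, 0) x := by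
      clear hh hf
      induction hc with
      | refl => exact ⟨_, represents_init w, .refl⟩
      | tail hc h ih =>
        obtain ⟨x, hx, hs⟩ := ih
        obtain ⟨y, hy, hr⟩ := hx.exists_sweepStep hlim hmark hc h
        exact ⟨y, hr, hs.tail hy⟩
    rw [hx.state] at hf
    rw [hx.head] at hh
    simp only at hf hh
    subst hh
    exact ⟨q, hf, k, hs⟩
  · rintro ⟨r, hr, k, hs⟩
    obtain ⟨c, hc, hx⟩ : ∃ c, M.Reachable w c ∧
        M.Represents mark w (r, w.length + 2, k) c := by
      generalize (r, w.length + 2, k) = x at hs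
      induction hs with
      | refl => exact ⟨_, .refl, represents_init w⟩
      | tail _ h ih =>
        obtain ⟨c, hc, hx⟩ := ih
        obtain ⟨c', hs, h₁, h₂⟩ := hx.exists_step h
        obtain ⟨z, hz, hr⟩ := hx.exists_sweepStep hlim hmark hc hs
        obtain rfl := h.eq_of_state_head hz (h₁.symm.trans hr.state) (h₂.symm.trans hr.head)
        exact ⟨c', hc.tail hs, hr⟩
    exact ⟨c, hc, hx.head, hx.state ▸ hr⟩

include hlim hmark in
theorem mem_language_iff_frontier (w : List A) :
    w ∈ M.language ↔ ∃ r ∈ M.final,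
      r ∈ M.frontier (symbolAt (w.map M.input)) (symbolAt (w.map mark)) (w.length + 1) := by
  simp only [mem_language_iff_sweep hlim hmark, exists_sweep_iff]

end Simulation

/-! ### The two one-way automata -/

section Automata

variable (M : TapeMachine Q A Γ) (mark : A → Γ)

/-- The one-way deterministic automaton that maintains the set of the states in which the machine
can reach the next new cell, and the crossing relation of the marked prefix. -/
def subsetDFA : DFA A (Set Q × (Q → Q → Prop)) where
  step s a :=
    ({p | ∃ q ∈ s.1, M.FirstExit s.2 (.sym (M.input a)) (.sym (mark a)) q p},
      M.Exit s.2 (.sym (mark a)))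
  start := ({M.start}, M.Exit (fun _ _ => False) .leftEnd)
  accept := {s | ∃ r ∈ M.final, ∃ q ∈ s.1, M.Exit s.2 .rightEnd q r}

/-- The one-way nondeterministic automaton that guesses the state in which the machine reaches the
next new cell, and maintains the crossing relation of the marked prefix. -/
def crossingNFA : NFA A (Q × (Q → Q → Prop)) where
  step s a :=
    {t | M.FirstExit s.2 (.sym (M.input a)) (.sym (mark a)) s.1 t.1 ∧
      t.2 = M.Exit s.2 (.sym (mark a))}
  start := {(M.start, M.Exit (fun _ _ => False) .leftEnd)}
  accept := {s | ∃ r ∈ M.final, M.Exit s.2 .rightEnd s.1 r}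

/-- Stated for prefixes of a fixed `w`, so that the tape contents stay the same throughout the
induction. -/
theorem eval_subsetDFA_take (w : List A) (j : ℕ) (hj : j ≤ w.length) :
    (M.subsetDFA mark).eval (w.take j) =
      (M.frontier (symbolAt (w.map M.input)) (symbolAt (w.map mark)) j,
        M.crossing (symbolAt (w.map mark)) j) := by
  induction j with
  | zero => rfl
  | succ j ih =>
    have hj' : j < w.length := hj
    rw [List.take_add_one, List.getElem?_eq_getElem hj', Option.toList_some,
      DFA.eval_append_singleton, ih (by omega)]
    simp [subsetDFA, frontier, crossing, symbolAt, hj']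

theorem mem_accepts_subsetDFA (w : List A) :
    w ∈ (M.subsetDFA mark).accepts ↔ ∃ r ∈ M.final,
      r ∈ M.frontier (symbolAt (w.map M.input)) (symbolAt (w.map mark)) (w.length + 1) := by
  have h := M.eval_subsetDFA_take mark w w.length le_rfl
  rw [List.take_length] at h
  rw [DFA.mem_accepts, h]
  simp [subsetDFA, frontier, symbolAt, firstExit_self]

theorem accepts_subsetDFA (hlim : M.IsOneLimited)
    (hmark : ∀ (w : List A) (c c' : Config Q Γ), M.Reachable w c → M.Step c c' →
      c.head ∉ c.visited →
        ∀ (i : ℕ) (a : A), c.head = i + 1 → w[i]? = some a → c'.cells[i]? = some (mark a)) :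
    (M.subsetDFA mark).accepts = M.language := by
  ext w
  rw [mem_accepts_subsetDFA, mem_language_iff_frontier hlim hmark]

/-- The relation evolves deterministically; only the state is guessed. -/
theorem mem_eval_crossingNFA (w : List A) (s : Q × (Q → Q → Prop)) :
    s ∈ (M.crossingNFA mark).eval w ↔
      s.1 ∈ ((M.subsetDFA mark).eval w).1 ∧ s.2 = ((M.subsetDFA mark).eval w).2 := by
  induction w using List.reverseRecOn generalizing s with
  | nil => exact Prod.ext_iff
  | append_singleton w a ih =>
    rw [NFA.eval_append_singleton, DFA.eval_append_singleton, NFA.mem_stepSet]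
    generalize (M.subsetDFA mark).eval w = t at ih
    constructor
    · rintro ⟨u, hu, h₁, h₂⟩
      obtain ⟨hu, hτ⟩ := (ih u).1 hu
      rw [hτ] at h₁ h₂
      exact ⟨⟨_, hu, h₁⟩, h₂⟩
    · rintro ⟨⟨q, hq, h₁⟩, h₂⟩
      exact ⟨(q, t.2), (ih _).2 ⟨hq, rfl⟩, h₁, h₂⟩

theorem accepts_crossingNFA : (M.crossingNFA mark).accepts = (M.subsetDFA mark).accepts := by
  ext w
  rw [NFA.mem_accepts, DFA.mem_accepts]
  change (∃ s ∈ (M.crossingNFA mark).accept, s ∈ (M.crossingNFA mark).eval w) ↔ _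
  simp only [mem_eval_crossingNFA]
  constructor
  · rintro ⟨s, ⟨r, hr, h⟩, hs, hτ⟩
    exact ⟨r, hr, s.1, hs, hτ ▸ h⟩
  · rintro ⟨r, hr, q, hq, h⟩
    exact ⟨(q, _), ⟨r, hr, h⟩, hq, rfl⟩

end Automata

end TapeMachine

/-! ### Renaming states and merging a trap -/

namespace NFA

variable {α σ σ' : Type*}

/-- Transport of an automaton along an equivalence of the state types. -/
def mapEquiv (g : σ ≃ σ') (N : NFA α σ) : NFA α σ' where
  step s a := g.symm ⁻¹' N.step (g.symm s) a
  start := g.symm ⁻¹' N.start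
  accept := g.symm ⁻¹' N.accept

theorem eval_mapEquiv (g : σ ≃ σ') (N : NFA α σ) (x : List α) :
    (N.mapEquiv g).eval x = g.symm ⁻¹' N.eval x := by
  induction x using List.reverseRecOn with
  | nil => rfl
  | append_singleton x a ih =>
    ext s
    rw [eval_append_singleton, ih, mem_stepSet, Set.mem_preimage, eval_append_singleton,
      mem_stepSet, ← g.symm.exists_congr_right]
    rfl

theorem accepts_mapEquiv (g : σ ≃ σ') (N : NFA α σ) : (N.mapEquiv g).accepts = N.accepts := by
  ext x
  change (∃ s ∈ (N.mapEquiv g).accept, s ∈ (N.mapEquiv g).eval x) ↔ ∃ s ∈ N.accept, s ∈ N.eval x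
  rw [eval_mapEquiv, ← g.symm.exists_congr_right]
  rfl

end NFA

namespace DFA

variable {α σ : Type*}

open Classical in
/-- The state outside of `dead`, or `none`. -/
noncomputable def aliveOrNone (dead : Set σ) (s : σ) : Option {s // s ∉ dead} :=
  if h : s ∉ dead then some ⟨s, h⟩ else none

/-- Merging the states of a trap `dead` into a single state. -/
noncomputable def mergeDead (D : DFA α σ) (dead : Set σ) : DFA α (Option {s // s ∉ dead}) where
  step s a := s.bind fun s => aliveOrNone dead (D.step s a)
  start := aliveOrNone dead D.start
  accept := {s | ∃ t ∈ s, t.1 ∈ D.accept}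

theorem eval_mergeDead (D : DFA α σ) {dead : Set σ} (hd : ∀ s ∈ dead, ∀ a, D.step s a ∈ dead)
    (x : List α) : (D.mergeDead dead).eval x = aliveOrNone dead (D.eval x) := by
  induction x using List.reverseRecOn with
  | nil => rfl
  | append_singleton x a ih =>
    rw [eval_append_singleton, eval_append_singleton, ih]
    by_cases h : D.eval x ∈ dead
    · simp [mergeDead, aliveOrNone, h, hd _ h a]
    · simp [mergeDead, aliveOrNone, h]

theorem accepts_mergeDead (D : DFA α σ) {dead : Set σ} (hd : ∀ s ∈ dead, ∀ a, D.step s a ∈ dead)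
    (hacc : ∀ s ∈ dead, s ∉ D.accept) : (D.mergeDead dead).accepts = D.accepts := by
  ext x
  rw [mem_accepts, mem_accepts, eval_mergeDead D hd]
  by_cases h : D.eval x ∈ dead
  · simp [mergeDead, aliveOrNone, h, hacc _ h]
  · simp [mergeDead, aliveOrNone, h]

end DFA

/-! ### State counts and conclusion -/

theorem card_rel (Q : Type*) [Fintype Q] :
    Nat.card (Q → Q → Prop) = 2 ^ (Fintype.card Q ^ 2) := by
  simp [Nat.card_fun, Nat.card_eq_fintype_card, ← pow_mul, sq]

theorem theorem6 {Q A Γ : Type*} [Fintype Q] [Finite A] [Finite Γ]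
    (M : TapeMachine Q A Γ) (hlim : M.IsOneLimited) (hmark : M.IsAlwaysMarking) :
    (∃ (S : Type) (_ : Fintype S) (N : NFA A S),
      (∃ s, N.start = {s}) ∧
      Fintype.card S ≤ Fintype.card Q * 2 ^ (Fintype.card Q ^ 2) ∧
      N.accepts = M.language) ∧
    (∃ (S : Type) (_ : Fintype S) (D : DFA A S),
      Fintype.card S ≤ (2 ^ Fintype.card Q - 1) * 2 ^ (Fintype.card Q ^ 2) + 1 ∧
      D.accepts = M.language) := by
  obtain ⟨mark, -, -, hmark⟩ := hmark
  have hD := M.accepts_subsetDFA mark hlim hmark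
  constructor
  -- The states must lie in `Type`, whatever the universe of `Q`; hence the passage to `Fin`.
  · let e := Finite.equivFin (Q × (Q → Q → Prop))
    refine ⟨_, inferInstance, (M.crossingNFA mark).mapEquiv e,
      ⟨e (M.start, M.Exit (fun _ _ => False) .leftEnd), ?_⟩, ?_, ?_⟩
    · ext s
      exact e.symm_apply_eq
    · rw [Fintype.card_fin, Nat.card_prod, card_rel, Nat.card_eq_fintype_card]
    · rw [NFA.accepts_mapEquiv, M.accepts_crossingNFA, hD]
  -- An empty set of states stays empty and never accepts. The live states have one of `2 ^ n - 1`
  -- nonempty sets; the trap adds `1`.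
  · let dead : Set (Set Q × (Q → Q → Prop)) := {∅} ×ˢ Set.univ
    let e := Finite.equivFin (Option {s // s ∉ dead})
    refine ⟨_, inferInstance, ((M.subsetDFA mark).mergeDead dead).reindex e, ?_, ?_⟩
    · have h : deadᶜ = ({∅}ᶜ : Set (Set Q)) ×ˢ (Set.univ : Set (Q → Q → Prop)) := by
        ext s
        simp [dead]
      rw [Fintype.card_fin, Finite.card_option]
      change Nat.card ↥(deadᶜ) + 1 ≤ _
      rw [h, Nat.card_coe_set_eq, Set.ncard_prod, Set.ncard_univ, card_rel, Set.ncard_compl,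
        Set.ncard_singleton]
      simp
    · rw [DFA.accepts_reindex, DFA.accepts_mergeDead, hD]
      · rintro s ⟨hs, -⟩ a
        simp only [Set.mem_singleton_iff] at hs
        simp [dead, TapeMachine.subsetDFA, hs]
      · rintro s ⟨hs, -⟩ ⟨r, -, q, hq, -⟩
        simp only [Set.mem_singleton_iff] at hs
        simp [hs] at hq
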